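/- Let $d\ge 1$ and let $T=(T_1,\dots,T_d)$ be a $d$-tuple of bounded operators on a complex Hilbert space $\mathfrak H$. Let $\mathbb F_d^+$ be the free semigroup with unit on $\{1,\dots,d\}$, i.e. the set of finite words, including the empty word; for $w=i_1\cdots i_s\in\mathbb F_d^+$ put $T_w=T_{i_1}\cdots T_{i_s}$, with $T_\emptyset=I$. Assume that $T$ is a pure cyclic row contraction, that is: - (row contraction) the row operator $[T_1,\dots,T_d]:\mathfrak H^{(d)}\to\mathfrak H$, $(\xi_1,\dots,\xi_d)\mapsto\sum_k T_k\xi_k$, is contractive; - (pure) $\lim_{n\to\infty}\sum_{|w|=n}\|T_w^*h\|^2=0$ for every $h\in\mathfrak H$; - (cyclic) $T$ has a cyclic vector, i.e. a vector $\eta\in\mathfrak H$ such that $\{T_w\eta:w\in\mathbb F_d^+\}$ has dense linear span in $\mathfrak H$. For $\xi\in\mathfrak H$ let $T_w\xi\otimes T_w\xi$ be the operator $h\mapsto\langle h,T_w\xi\rangle T_w\xi$. Then there is a vector $\xi\in\mathfrak H$ that is cyclic for $T$ and satisfies $$\sum_{w\in\mathbb F_d^+}T_w\xi\otimes T_w\xi\le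 I,$$ where the sum converges in the strong operator topology. Moreover, for every cyclic vector $\xi$ of $T$ with this property the following statements hold. 1. If $\|T_w\xi\|=1$ for every $w\in\mathbb F_d^+$, then $T$ is unitarily equivalent to the standard $d$-shift, i.e. there is a unitary $U:\mathfrak H\to\mathfrak F_d^2$ with $UT_k=L_kU$ for $1\le k\le d$. Here $\mathfrak F^2_d=\mathbb C\oplus\bigoplus_{n\ge1}(\mathbb C^d)^{\otimes n}$ is the full Fock space over $\mathbb C^d$, and $L_kv=e_k\otimes v$ for the standard orthonormal basis $e_1,\dots,e_d$ of $\mathbb C^d$. 2. If $d>1$ and $T_1,\dots,T_d$ commute with each other, then $\|T_w\xi\|<1$ for some $w\in\mathbb F_d^+$. -/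

import Mathlib

noncomputable section

namespace CyclicRow

open scoped TensorProduct InnerProductSpace
open Filter Topology

/-! ### The full Fock space and the standard `d`-shift -/

/-- A bundled complex inner product space, used only to define tensor powers by recursion. -/
structure InnerSpace where
  carrier : Type
  [grp : NormedAddCommGroup carrier]
  [ips : InnerProductSpace ℂ carrier]

attribute [instance] InnerSpace.grp InnerSpace.ips

/-- The inner product space `(ℂ^d)^{⊗ n}`; the zeroth tensor power is `ℂ`. -/
def tensorPow (d : ℕ) : ℕ → InnerSpace
  | 0 => ⟨ℂ⟩
  | n + 1 => ⟨EuclideanSpace ℂ (Fin d) ⊗[ℂ] (tensorPow d n).carrier⟩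

/-- The `n`-particle space `(ℂ^d)^{⊗ n}`. -/
abbrev FockLevel (d n : ℕ) : Type := (tensorPow d n).carrier

/-- The full Fock space `ℂ ⊕ ⨁_{n ≥ 1} (ℂ^d)^{⊗ n}` over `ℂ^d` (Hilbert space direct sum). -/
abbrev FullFock (d : ℕ) : Type := lp (fun n : ℕ => FockLevel d n) 2

/-- The map `v ↦ e ⊗ v` from `(ℂ^d)^{⊗ n}` to `(ℂ^d)^{⊗ (n+1)}`. -/
def tensorLeft {d : ℕ} (e : EuclideanSpace ℂ (Fin d)) (n : ℕ) :
    FockLevel d n →ₗ[ℂ] FockLevel d (n + 1) :=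
  TensorProduct.mk ℂ (EuclideanSpace ℂ (Fin d)) (FockLevel d n) e

theorem norm_tensorLeft {d : ℕ} (e : EuclideanSpace ℂ (Fin d)) (n : ℕ) (v : FockLevel d n) :
    ‖tensorLeft e n v‖ = ‖e‖ * ‖v‖ :=
  TensorProduct.norm_tmul e v

/-- The components of `e ⊗ v` for `v = (v₀, v₁, v₂, …)`: these are `(0, e ⊗ v₀, e ⊗ v₁, …)`. -/
def creationFun {d : ℕ} (e : EuclideanSpace ℂ (Fin d)) (v : (n : ℕ) → FockLevel d n) :
    (n : ℕ) → FockLevel d n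
  | 0 => 0
  | n + 1 => tensorLeft e n (v n)

theorem hasSum_creationFun {d : ℕ} (e : EuclideanSpace ℂ (Fin d)) (v : FullFock d) :
    HasSum (fun n => ‖creationFun e v n‖ ^ (2 : ℝ)) ((‖e‖ * ‖v‖) ^ (2 : ℝ)) := by
  have h := lp.hasSum_norm (p := 2) (by norm_num) v
  simp only [ENNReal.toReal_ofNat] at h
  rw [← hasSum_nat_add_iff' 1]
  have h2 := h.mul_left (‖e‖ ^ (2 : ℝ))
  simpa [creationFun, norm_tensorLeft, Real.mul_rpow, mul_pow] using h2

/-- The left creation operator `v ↦ e ⊗ v` on the full Fock space. -/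
def creation {d : ℕ} (e : EuclideanSpace ℂ (Fin d)) : FullFock d →L[ℂ] FullFock d :=
  LinearMap.mkContinuous
    { toFun := fun v => ⟨creationFun e v,
        memℓp_gen (by simpa using (hasSum_creationFun e v).summable)⟩
      map_add' := by
        intro v w
        ext n
        cases n with
        | zero => exact (add_zero (0 : FockLevel d 0)).symm
        | succ n => exact map_add (tensorLeft e n) (v n) (w n)
      map_smul' := by
        intro c v
        ext n
        cases n with
        | zero => exact (smul_zero (A := FockLevel d 0) c).symm
        | succ n => exact map_smul (tensorLeft e n) c (v n) }
    ‖e‖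
    (by
      intro v
      refine lp.norm_le_of_tsum_le (p := 2) (by norm_num) (by positivity) ?_
      simpa using (hasSum_creationFun e v).tsum_eq.le)

/-- The standard `d`-shift `L = (L₁, …, L_d)`, with `L_k v = e_k ⊗ v`. -/
def standardShift (d : ℕ) (k : Fin d) : FullFock d →L[ℂ] FullFock d :=
  creation (EuclideanSpace.single k (1 : ℂ))

/-! ### Tuples of operators on a Hilbert space -/

section Tuples

variable {H : Type*} [NormedAddCommGroup H] [InnerProductSpace ℂ H] {d : ℕ}

/-- For a word `w = i₁ i₂ … i_s` (possibly empty), `T_w = T_{i₁} T_{i₂} ⋯ T_{i_s}`. -/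
def wordOp (T : Fin d → H →L[ℂ] H) (w : FreeMonoid (Fin d)) : H →L[ℂ] H :=
  FreeMonoid.lift T w

/-- The row operator `[T₁, …, T_d] : H ⊕ ⋯ ⊕ H → H`. -/
def rowOperator (T : Fin d → H →L[ℂ] H) : PiLp 2 (fun _ : Fin d => H) →L[ℂ] H :=
  ∑ k, (T k).comp (PiLp.proj 2 (fun _ : Fin d => H) k)

def IsRowContraction (T : Fin d → H →L[ℂ] H) : Prop := ‖rowOperator T‖ ≤ 1

/-- Purity: `∑_{|w| = n} ‖T_w^* x‖² → 0` as `n → ∞`, for every `x`. -/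
def IsPure [CompleteSpace H] (T : Fin d → H →L[ℂ] H) : Prop :=
  ∀ x : H, Tendsto
    (fun n : ℕ => ∑ u : Fin n → Fin d,
      ‖ContinuousLinearMap.adjoint (wordOp T (FreeMonoid.ofList (List.ofFn u))) x‖ ^ 2)
    atTop (𝓝 0)

/-- `ξ` is cyclic for `T` if the closed linear span of `{T_w ξ}` is the whole space. -/
def IsCyclicVector (T : Fin d → H →L[ℂ] H) (ξ : H) : Prop :=
  (Submodule.span ℂ (Set.range fun w : FreeMonoid (Fin d) => wordOp T w ξ)).topologicalClosure = ⊤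

def IsCyclic (T : Fin d → H →L[ℂ] H) : Prop := ∃ ξ : H, IsCyclicVector T ξ

def IsCommuting (T : Fin d → H →L[ℂ] H) : Prop := ∀ j k, T j * T k = T k * T j

/-- `∑_w T_w ξ ⊗ T_w ξ ≤ I`: the sum of rank-one operators converges (unconditionally, in the
strong operator topology) to a bounded operator which is at most the identity. -/
def WeaklyOrthogonal (T : Fin d → H →L[ℂ] H) (ξ : H) : Prop :=
  ∃ S : H →L[ℂ] H,
    (∀ h : H, HasSum (fun w : FreeMonoid (Fin d) =>
      InnerProductSpace.rankOne ℂ (wordOp T w ξ) (wordOp T w ξ) h) (S h)) ∧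
    S ≤ ContinuousLinearMap.id ℂ H

/-- Unitary equivalence of `d`-tuples of operators. -/
def UnitarilyEquivalent {K : Type*} [NormedAddCommGroup K] [InnerProductSpace ℂ K]
    (T : Fin d → H →L[ℂ] H) (V : Fin d → K →L[ℂ] K) : Prop :=
  ∃ U : H ≃ₗᵢ[ℂ] K, ∀ k x, U (T k x) = V k (U x)

end Tuples

end CyclicRow

end

/-!
A pure row contraction `T` dilates to a multiple of the shift. With a defect operator `Δ` such that
`Δ^*Δ = I - ∑ T_k T_k^*`, the map `W x = (Δ T_w^* x)_w` is isometric from `H` into the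
square-summable `H`-valued functions on words: the sum of `‖Δ T_w^* x‖²` over the words of length
`n` is `∑_{|w|=n} ‖T_w^* x‖² - ∑_{|w|=n+1} ‖T_w^* x‖²`, so the sum over all words telescopes, and
purity kills the remainder. Moreover `W^* L_k = T_k W^*` for the shift `L` on words
(`exists_isometry_intertwining`).

For existence, let `η` be cyclic and let `M` be the closed `L`-invariant subspace generated by
`W η`. The component `ω` of `W η` orthogonal to `⋁_{w ≠ ∅} L_w W η` spans the wandering subspace of
`M`, so after normalization its orbit `L_w ω` is orthonormal with closed span `M`
(`IsRowIsometry.exists_orthonormal_generator`). Then `ξ = W^* ω` satisfies `T_w ξ = W^* L_w ω`.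
Hence `∑ T_w ξ ⊗ T_w ξ = W^* P_M W ≤ I`, and `ξ` is cyclic because the closed span of its orbit
contains `W^* W η = η`.

Conversely, `∑ T_w ξ ⊗ T_w ξ ≤ I` gives `∑_w |⟨T_w ξ, T_v ξ⟩|² ≤ ‖T_v ξ‖²` for every word `v`. If no
`T_w ξ` has norm less than one, the diagonal term `‖T_v ξ‖⁴` already exhausts this bound, so the
vectors `T_w ξ` are orthonormal (`WeaklyOrthogonal.orthonormal`). Matching this basis with the orbit
of the vacuum gives the unitary equivalence with the standard shift; and commuting operators are
excluded for `d > 1`, since then the distinct words `12` and `21` give the same vector.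
-/

noncomputable section

namespace CyclicRow

open scoped InnerProductSpace
open Filter Topology ContinuousLinearMap

/-! ### Word operators and orbit closures -/

section Words

variable {K : Type*} [NormedAddCommGroup K] [InnerProductSpace ℂ K] {d : ℕ}

lemma inner_self_eq_ofReal_norm_sq (x : K) : ⟪x, x⟫_ℂ = ((‖x‖ ^ 2 : ℝ) : ℂ) := by
  rw [inner_self_eq_norm_sq_to_K]
  push_cast
  rfl

@[simp]
lemma wordOp_one_apply (V : Fin d → K →L[ℂ] K) (x : K) : wordOp V 1 x = x := by
  simp [wordOp]

lemma wordOp_of_mul_apply (V : Fin d → K →L[ℂ] K) (k : Fin d) (w : FreeMonoid (Fin d)) (x : K) :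
    wordOp V (FreeMonoid.of k * w) x = V k (wordOp V w x) := by
  simp [wordOp]

/-- The smallest closed subspace that contains `ζ` and is invariant under every `V_k`. -/
def orbitClosure (V : Fin d → K →L[ℂ] K) (ζ : K) : Submodule ℂ K :=
  (Submodule.span ℂ (Set.range fun w : FreeMonoid (Fin d) => wordOp V w ζ)).topologicalClosure

lemma isClosed_orbitClosure (V : Fin d → K →L[ℂ] K) (ζ : K) :
    IsClosed (orbitClosure V ζ : Set K) :=
  Submodule.isClosed_topologicalClosure _

lemma wordOp_mem_orbitClosure (V : Fin d → K →L[ℂ] K) (ζ : K) (w : FreeMonoid (Fin d)) :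
    wordOp V w ζ ∈ orbitClosure V ζ :=
  Submodule.le_topologicalClosure _ (Submodule.subset_span ⟨w, rfl⟩)

lemma self_mem_orbitClosure (V : Fin d → K →L[ℂ] K) (ζ : K) : ζ ∈ orbitClosure V ζ := by
  simpa using wordOp_mem_orbitClosure V ζ 1

/-- A bounded operator maps the closed span of `s` into any closed subspace that contains the
image of `s`. -/
lemma map_mem_of_mem_closure_span {L : Type*} [NormedAddCommGroup L] [InnerProductSpace ℂ L]
    {s : Set K} {P : Submodule ℂ L} (hP : IsClosed (P : Set L)) (f : K →L[ℂ] L)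
    (h : ∀ x ∈ s, f x ∈ P) {x : K} (hx : x ∈ (Submodule.span ℂ s).topologicalClosure) :
    f x ∈ P := by
  have : (Submodule.span ℂ s).topologicalClosure ≤ P.comap f.toLinearMap :=
    Submodule.topologicalClosure_minimal _ (Submodule.span_le.2 h) (hP.preimage f.continuous)
  exact this hx

lemma map_mem_of_mem_orbitClosure {L : Type*} [NormedAddCommGroup L] [InnerProductSpace ℂ L]
    {V : Fin d → K →L[ℂ] K} {ζ : K} {P : Submodule ℂ L} (hP : IsClosed (P : Set L))
    (f : K →L[ℂ] L) (h : ∀ w, f (wordOp V w ζ) ∈ P) {x : K} (hx : x ∈ orbitClosure V ζ) :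
    f x ∈ P :=
  map_mem_of_mem_closure_span hP f (by rintro _ ⟨w, rfl⟩; exact h w) hx

lemma orbitClosure_le {V : Fin d → K →L[ℂ] K} {ζ : K} {P : Submodule ℂ K}
    (hP : IsClosed (P : Set K)) (h : ∀ w, wordOp V w ζ ∈ P) : orbitClosure V ζ ≤ P :=
  fun _ hx => map_mem_of_mem_orbitClosure hP (ContinuousLinearMap.id ℂ K) h hx

lemma apply_mem_orbitClosure {V : Fin d → K →L[ℂ] K} {ζ x : K} (k : Fin d)
    (hx : x ∈ orbitClosure V ζ) : V k x ∈ orbitClosure V ζ :=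
  map_mem_of_mem_orbitClosure (isClosed_orbitClosure V ζ) (V k)
    (fun w => by rw [← wordOp_of_mul_apply]; exact wordOp_mem_orbitClosure V ζ _) hx

lemma wordOp_mem_orbitClosure_of_mem {V : Fin d → K →L[ℂ] K} {ζ x : K} (w : FreeMonoid (Fin d))
    (hx : x ∈ orbitClosure V ζ) : wordOp V w x ∈ orbitClosure V ζ := by
  induction w using FreeMonoid.inductionOn' with
  | one => simpa using hx
  | of_mul k w ih => rw [wordOp_of_mul_apply]; exact apply_mem_orbitClosure k ih

/-! ### Row isometries and their cyclic invariant subspaces -/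

/-- The operators `V_k` are isometries with pairwise orthogonal ranges. -/
def IsRowIsometry (V : Fin d → K →L[ℂ] K) : Prop :=
  ∀ j k x y, ⟪V j x, V k y⟫_ℂ = if j = k then ⟪x, y⟫_ℂ else 0

/-- A unit vector orthogonal to the rest of its orbit under a row isometry has an orthonormal
orbit: common prefixes of two words cancel. -/
lemma IsRowIsometry.orthonormal_wordOp {V : Fin d → K →L[ℂ] K} (hV : IsRowIsometry V) {ω : K}
    (h1 : ‖ω‖ = 1) (h0 : ∀ k w, ⟪ω, V k (wordOp V w ω)⟫_ℂ = 0) :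
    Orthonormal ℂ (fun w : FreeMonoid (Fin d) => wordOp V w ω) := by
  classical
  rw [orthonormal_iff_ite]
  intro u
  induction u using FreeMonoid.inductionOn' with
  | one =>
    intro w
    induction w using FreeMonoid.inductionOn' with
    | one => simp [inner_self_eq_norm_sq_to_K, h1]
    | of_mul k w _ =>
      have hne : (1 : FreeMonoid (Fin d)) ≠ FreeMonoid.of k * w := (List.cons_ne_nil k w).symm
      rw [wordOp_of_mul_apply, wordOp_one_apply, h0, if_neg hne]
  | of_mul j u ih =>
    intro w
    induction w using FreeMonoid.inductionOn' with
    | one =>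
      have hne : FreeMonoid.of j * u ≠ (1 : FreeMonoid (Fin d)) := List.cons_ne_nil j u
      rw [wordOp_of_mul_apply, wordOp_one_apply, if_neg hne, ← inner_conj_symm, h0, map_zero]
    | of_mul k w _ =>
      have hiff : FreeMonoid.of j * u = FreeMonoid.of k * w ↔ j = k ∧ u = w := List.cons_eq_cons
      rw [wordOp_of_mul_apply, wordOp_of_mul_apply, hV, ih]
      simp only [hiff, ite_and]

/-- Beurling-type theorem for a cyclic invariant subspace of a pure row isometry. Purity is
expressed by a set `E` of vectors orthogonal to the ranges of the `V_k` whose orbits span a dense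
subspace. The generator is the normalized component of `ζ` orthogonal to
`⋁_{w ≠ ∅} V_w ζ`. -/
theorem IsRowIsometry.exists_orthonormal_generator [CompleteSpace K] {V : Fin d → K →L[ℂ] K}
    (hV : IsRowIsometry V) (E : Set K) (hE : ∀ e ∈ E, ∀ k x, ⟪e, V k x⟫_ℂ = 0)
    (htotal : ∀ y : K, (∀ w, ∀ e ∈ E, ⟪wordOp V w e, y⟫_ℂ = 0) → y = 0) {ζ : K} (hζ : ζ ≠ 0) :
    ∃ ω : K, Orthonormal ℂ (fun w : FreeMonoid (Fin d) => wordOp V w ω) ∧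
      ζ ∈ orbitClosure V ω := by
  set M := orbitClosure V ζ with hM
  set M' : Submodule ℂ K := (Submodule.span ℂ
    (Set.range fun p : Fin d × FreeMonoid (Fin d) => V p.1 (wordOp V p.2 ζ))).topologicalClosure
    with hM'
  have hM'c : IsClosed (M' : Set K) := Submodule.isClosed_topologicalClosure _
  have hMc : IsClosed (M : Set K) := isClosed_orbitClosure V ζ
  have : CompleteSpace M' := hM'c.completeSpace_coe
  have hVM : ∀ k, ∀ x ∈ M, V k x ∈ M' := fun k x hx =>
    map_mem_of_mem_orbitClosure hM'c (V k)
      (fun w => Submodule.le_topologicalClosure _ (Submodule.subset_span ⟨(k, w), rfl⟩)) hx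
  have hM'M : M' ≤ M := by
    refine Submodule.topologicalClosure_minimal _ (Submodule.span_le.2 ?_) hMc
    rintro _ ⟨⟨k, w⟩, rfl⟩
    exact apply_mem_orbitClosure k (wordOp_mem_orbitClosure V ζ w)
  obtain ⟨m, hm, ω, hω, hsum⟩ := M'.exists_add_mem_mem_orthogonal ζ
  rw [Submodule.mem_orthogonal'] at hω
  have hωM : ω ∈ M := by
    rw [show ω = ζ - m by rw [hsum]; abel]
    exact M.sub_mem (self_mem_orbitClosure V ζ) (hM'M hm)
  -- `M'` has codimension at most one in `M`, with `ω` spanning the complement.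
  have hdrop : ∀ y ∈ M, ⟪ω, y⟫_ℂ = 0 → y ∈ M' := by
    intro y hy hωy
    obtain ⟨p, hp, q, hq, rfl⟩ := M'.exists_add_mem_mem_orthogonal y
    rw [Submodule.mem_orthogonal'] at hq
    have hqM : q ∈ M := by simpa using M.sub_mem hy (hM'M hp)
    have hωq : ⟪ω, q⟫_ℂ = 0 := by simpa [inner_add_right, hω p hp] using hωy
    have hqω : ⟪q, ω⟫_ℂ = 0 := by rw [← inner_conj_symm, hωq, map_zero]
    have hker : ∀ x ∈ M, innerSL ℂ q x ∈ (⊥ : Submodule ℂ ℂ) := by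
      intro x hx
      refine map_mem_of_mem_orbitClosure (by simp) (innerSL ℂ q) (fun w => ?_) hx
      induction w using FreeMonoid.inductionOn' with
      | one => simp [hsum, inner_add_right, hq m hm, hqω]
      | of_mul k w _ =>
        rw [wordOp_of_mul_apply]
        simpa using hq _ (hVM k _ (wordOp_mem_orbitClosure V ζ w))
    have hq0 : q = 0 := by simpa using hker q hqM
    simpa [hq0] using hp
  have hback : ∀ k, ∀ y ∈ M', adjoint (V k) y ∈ M := by
    intro k y hy
    refine map_mem_of_mem_closure_span hMc (adjoint (V k)) ?_ hy
    rintro _ ⟨⟨j, w⟩, rfl⟩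
    have : adjoint (V k) (V j (wordOp V w ζ)) = if k = j then wordOp V w ζ else 0 := by
      refine ext_inner_left ℂ fun x => ?_
      rw [adjoint_inner_right, hV]
      split_ifs <;> simp
    simp only [this]
    split_ifs
    · exact wordOp_mem_orbitClosure V ζ w
    · exact M.zero_mem
  -- A vector of `M` orthogonal to the orbit of `ω` stays so under each adjoint `V_k^*`.
  have hvanish : ∀ w y, y ∈ M → (∀ u, ⟪wordOp V u ω, y⟫_ℂ = 0) →
      ∀ e ∈ E, ⟪wordOp V w e, y⟫_ℂ = 0 := by
    intro w
    induction w using FreeMonoid.inductionOn' with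
    | one =>
      intro y hy hyω e he
      have hyM' : y ∈ M' := hdrop y hy (by simpa using hyω 1)
      have := map_mem_of_mem_closure_span (P := (⊥ : Submodule ℂ ℂ)) (by simp) (innerSL ℂ e)
        (by rintro _ ⟨⟨k, u⟩, rfl⟩; simpa using hE e he k _) hyM'
      simpa using this
    | of_mul k w ih =>
      intro y hy hyω e he
      have hyM' : y ∈ M' := hdrop y hy (by simpa using hyω 1)
      rw [wordOp_of_mul_apply, ← adjoint_inner_right]
      refine ih _ (hback k y hyM') (fun u => ?_) e he
      rw [adjoint_inner_right, ← wordOp_of_mul_apply]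
      exact hyω _
  have hζω : ζ ∈ orbitClosure V ω := by
    have : CompleteSpace (orbitClosure V ω) := (isClosed_orbitClosure V ω).completeSpace_coe
    obtain ⟨n, hn, y, hy, hny⟩ := (orbitClosure V ω).exists_add_mem_mem_orthogonal ζ
    have hNM : orbitClosure V ω ≤ M :=
      orbitClosure_le hMc fun w => wordOp_mem_orbitClosure_of_mem w hωM
    have hyM : y ∈ M := by
      rw [show y = ζ - n by rw [hny]; abel]
      exact M.sub_mem (self_mem_orbitClosure V ζ) (hNM hn)
    have hy0 : y = 0 := htotal y fun w e he => hvanish w y hyM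
      (fun u => hy _ (wordOp_mem_orbitClosure V ω u)) e he
    rw [hny, hy0, add_zero]
    exact hn
  have hω0 : ω ≠ 0 := by
    rintro rfl
    have := map_mem_of_mem_orbitClosure (P := (⊥ : Submodule ℂ K)) (by simp)
      (ContinuousLinearMap.id ℂ K) (fun w => by simp) hζω
    exact hζ (by simpa using this)
  have hn0 : (‖ω‖ : ℂ) ≠ 0 := by simpa using hω0
  refine ⟨(‖ω‖⁻¹ : ℂ) • ω, hV.orthonormal_wordOp ?_ fun k w => ?_, ?_⟩
  · rw [norm_smul, norm_inv, Complex.norm_real, norm_norm, inv_mul_cancel₀ (norm_ne_zero_iff.2 hω0)]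
  · rw [map_smul, map_smul, inner_smul_left, inner_smul_right,
      hω _ (hVM k _ (wordOp_mem_orbitClosure_of_mem w hωM)), mul_zero, mul_zero]
  · refine orbitClosure_le (isClosed_orbitClosure V _) (fun w => ?_) hζω
    have := (orbitClosure V ((‖ω‖⁻¹ : ℂ) • ω)).smul_mem (‖ω‖ : ℂ)
      (wordOp_mem_orbitClosure V ((‖ω‖⁻¹ : ℂ) • ω) w)
    rwa [map_smul, smul_inv_smul₀ hn0] at this

end Words

/-! ### The shift on square-summable functions on words -/

section WordShift

instance decidableEq_word (d : ℕ) : DecidableEq (FreeMonoid (Fin d)) :=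
  inferInstanceAs (DecidableEq (List (Fin d)))

variable (H : Type*) [NormedAddCommGroup H] [InnerProductSpace ℂ H] (d : ℕ)

/-- The Hilbert space of square-summable `H`-valued functions on words, a coordinate model of
the full Fock space tensored with `H`. -/
abbrev WordSpace : Type _ := lp (fun _ : FreeMonoid (Fin d) => H) 2

variable {d}

/-- The isometric embedding of `H` as the functions supported at the word `w`. -/
def singleIsometry (w : FreeMonoid (Fin d)) : H →ₗᵢ[ℂ] WordSpace H d where
  toFun x := lp.single 2 w x
  map_add' := lp.single_add (E := fun _ : FreeMonoid (Fin d) => H) 2 w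
  map_smul' c x := lp.single_smul (E := fun _ : FreeMonoid (Fin d) => H) 2 w c x
  norm_map' := lp.norm_single (E := fun _ : FreeMonoid (Fin d) => H) (p := 2) two_pos w

variable {H}

lemma inner_singleIsometry (w : FreeMonoid (Fin d)) (x : H) (f : WordSpace H d) :
    ⟪singleIsometry H w x, f⟫_ℂ = ⟪x, (f w : H)⟫_ℂ :=
  lp.inner_single_left (G := fun _ : FreeMonoid (Fin d) => H) w x f

lemma singleIsometry_apply_ne {u w : FreeMonoid (Fin d)} (h : w ≠ u) (x : H) :
    (singleIsometry H u x w : H) = 0 :=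
  lp.single_apply_ne (E := fun _ : FreeMonoid (Fin d) => H) 2 u x h

lemma wordSpace_ext {f g : WordSpace H d}
    (h : ∀ w (x : H), ⟪singleIsometry H w x, f⟫_ℂ = ⟪singleIsometry H w x, g⟫_ℂ) : f = g := by
  refine lp.ext (funext fun w => ?_)
  exact ext_inner_left ℂ fun x : H => by simpa only [inner_singleIsometry] using h w x

variable (H)

lemma orthogonalFamily_singleIsometry_of_mul (k : Fin d) :
    OrthogonalFamily ℂ (fun _ : FreeMonoid (Fin d) => H)
      (fun w => singleIsometry H (FreeMonoid.of k * w)) := by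
  intro u w huw x y
  have hne : FreeMonoid.of k * u ≠ FreeMonoid.of k * w := fun h => huw (mul_left_cancel h)
  rw [inner_singleIsometry, singleIsometry_apply_ne hne, inner_zero_right]

variable [CompleteSpace H]

/-- The shift that moves the value at the word `w` to the word `kw`. -/
def wordShift (k : Fin d) : WordSpace H d →L[ℂ] WordSpace H d :=
  (orthogonalFamily_singleIsometry_of_mul H k).linearIsometry.toContinuousLinearMap

variable {H}

lemma wordShift_single (k : Fin d) (w : FreeMonoid (Fin d)) (x : H) :
    wordShift H k (singleIsometry H w x) = singleIsometry H (FreeMonoid.of k * w) x :=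
  (orthogonalFamily_singleIsometry_of_mul H k).linearIsometry_apply_single (i := w) x

lemma adjoint_wordShift_apply (k : Fin d) (f : WordSpace H d) (w : FreeMonoid (Fin d)) :
    (adjoint (wordShift H k) f w : H) = f (FreeMonoid.of k * w) := by
  refine ext_inner_left ℂ fun x : H => ?_
  rw [← inner_singleIsometry w x, adjoint_inner_right, wordShift_single, inner_singleIsometry]

/-- The range of the `k`-th shift is orthogonal to the functions supported at a word that does not
begin with `k`. -/
lemma inner_singleIsometry_wordShift {k : Fin d} {w : FreeMonoid (Fin d)}
    (hw : ∀ v, FreeMonoid.of k * v ≠ w) (x : H) (f : WordSpace H d) :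
    ⟪singleIsometry H w x, wordShift H k f⟫_ℂ = 0 := by
  have h : adjoint (wordShift H k) (singleIsometry H w x) = 0 :=
    wordSpace_ext fun v y => by
      rw [inner_singleIsometry, adjoint_wordShift_apply, singleIsometry_apply_ne (hw v),
        inner_zero_right, inner_zero_right]
  rw [← adjoint_inner_left, h, inner_zero_left]

lemma wordOp_wordShift_single (u w : FreeMonoid (Fin d)) (x : H) :
    wordOp (wordShift H) u (singleIsometry H w x) = singleIsometry H (u * w) x := by
  induction u using FreeMonoid.inductionOn' with
  | one => simp
  | of_mul k u ih => rw [wordOp_of_mul_apply, ih, wordShift_single, mul_assoc]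

lemma isRowIsometry_wordShift : IsRowIsometry (wordShift H (d := d)) := by
  intro j k f g
  split_ifs with h
  · subst h
    exact (orthogonalFamily_singleIsometry_of_mul H j).linearIsometry.inner_map_map f g
  · have h0 : adjoint (wordShift H k) (wordShift H j f) = 0 :=
      wordSpace_ext fun w x => by
        rw [adjoint_inner_right, wordShift_single, inner_zero_right]
        exact inner_singleIsometry_wordShift (fun v e => h (List.cons_eq_cons.1 e).1) x f
    rw [← adjoint_inner_left, h0, inner_zero_left]

/-- A nonzero cyclic invariant subspace of the word shift is generated by a vector with
orthonormal orbit. -/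
lemma exists_orthonormal_generator_wordShift {ζ : WordSpace H d} (hζ : ζ ≠ 0) :
    ∃ ω : WordSpace H d,
      Orthonormal ℂ (fun w : FreeMonoid (Fin d) => wordOp (wordShift H) w ω) ∧
      ζ ∈ orbitClosure (wordShift H) ω := by
  refine isRowIsometry_wordShift.exists_orthonormal_generator
    (Set.range (singleIsometry H 1)) ?_ ?_ hζ
  · rintro _ ⟨x, rfl⟩ k f
    exact inner_singleIsometry_wordShift (fun v => List.cons_ne_nil k v) x f
  · intro y hy
    refine wordSpace_ext fun w x => ?_
    simpa [wordOp_wordShift_single] using hy w _ ⟨x, rfl⟩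

end WordShift

/-! ### The Poisson isometry of a pure row contraction -/

section Poisson

variable {H : Type*} [NormedAddCommGroup H] [InnerProductSpace ℂ H] [CompleteSpace H] {d : ℕ}

lemma IsRowContraction.sum_norm_adjoint_sq_le {T : Fin d → H →L[ℂ] H} (hT : IsRowContraction T)
    (x : H) : ∑ k, ‖adjoint (T k) x‖ ^ 2 ≤ ‖x‖ ^ 2 := by
  set y : PiLp 2 (fun _ : Fin d => H) := WithLp.toLp 2 fun k => adjoint (T k) x with hy
  have hnorm : ‖y‖ ^ 2 = ∑ k, ‖adjoint (T k) x‖ ^ 2 := by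
    rw [PiLp.norm_sq_eq_of_L2]
  have hinner : ⟪rowOperator T y, x⟫_ℂ = ((‖y‖ ^ 2 : ℝ) : ℂ) := by
    rw [hnorm]
    simp only [rowOperator, sum_apply, ContinuousLinearMap.comp_apply,
      PiLp.proj_apply, sum_inner]
    rw [Complex.ofReal_sum]
    refine Finset.sum_congr rfl fun k _ => ?_
    rw [← adjoint_inner_right, hy, inner_self_eq_ofReal_norm_sq]
  have hle : ‖y‖ ^ 2 ≤ ‖y‖ * ‖x‖ := by
    calc ‖y‖ ^ 2 = ‖⟪rowOperator T y, x⟫_ℂ‖ := by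
          rw [hinner, Complex.norm_real, Real.norm_of_nonneg (sq_nonneg _)]
      _ ≤ ‖rowOperator T y‖ * ‖x‖ := norm_inner_le_norm _ _
      _ ≤ ‖y‖ * ‖x‖ := by
          gcongr
          simpa using (rowOperator T).le_of_opNorm_le hT y
  rw [← hnorm]
  have : ‖y‖ ≤ ‖x‖ := by
    rcases (norm_nonneg y).eq_or_lt with h | h
    · rw [← h]; exact norm_nonneg x
    · rw [sq] at hle; exact le_of_mul_le_mul_left hle h
  gcongr

/-- A defect operator `Δ` with `Δ^*Δ = I - ∑ T_k T_k^*`. -/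
lemma IsRowContraction.exists_defect {T : Fin d → H →L[ℂ] H} (hT : IsRowContraction T) :
    ∃ D : H →L[ℂ] H, ∀ x, ‖D x‖ ^ 2 = ‖x‖ ^ 2 - ∑ k, ‖adjoint (T k) x‖ ^ 2 := by
  set B : H →L[ℂ] H := 1 - ∑ k, T k * star (T k) with hB
  have hinner : ∀ x, ⟪B x, x⟫_ℂ = ((‖x‖ ^ 2 - ∑ k, ‖adjoint (T k) x‖ ^ 2 : ℝ) : ℂ) := by
    intro x
    have h (k : Fin d) : ⟪T k (adjoint (T k) x), x⟫_ℂ = ((‖adjoint (T k) x‖ ^ 2 : ℝ) : ℂ) := by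
      rw [← adjoint_inner_right, inner_self_eq_ofReal_norm_sq]
    have hBx : B x = x - ∑ k, T k (adjoint (T k) x) := by
      simp [hB, star_eq_adjoint]
    rw [hBx, inner_sub_left, sum_inner, Complex.ofReal_sub, Complex.ofReal_sum,
      inner_self_eq_ofReal_norm_sq]
    simp only [h]
  have hpos : 0 ≤ B := by
    rw [nonneg_iff_isPositive, isPositive_iff_complex]
    intro x
    rw [hinner]
    refine ⟨congrArg _ (Complex.ofReal_re _), ?_⟩
    rw [RCLike.re_to_complex, Complex.ofReal_re]
    linarith [hT.sum_norm_adjoint_sq_le x]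
  obtain ⟨D, hD⟩ := CStarAlgebra.nonneg_iff_eq_star_mul_self.1 hpos
  refine ⟨D, fun x => ?_⟩
  have h1 : ⟪B x, x⟫_ℂ = ((‖D x‖ ^ 2 : ℝ) : ℂ) := by
    rw [← inner_self_eq_ofReal_norm_sq, ← adjoint_inner_left, hD]
    rfl
  exact Complex.ofReal_injective (h1.symm.trans (hinner x))

/-- Words of length `n + 1` are a letter followed by a word of length `n`. -/
lemma sum_ofFn_succ {α : Type*} [AddCommMonoid α] (F : FreeMonoid (Fin d) → α) (n : ℕ) :
    ∑ u : Fin (n + 1) → Fin d, F (FreeMonoid.ofList (List.ofFn u)) =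
      ∑ k, ∑ u : Fin n → Fin d, F (FreeMonoid.of k * FreeMonoid.ofList (List.ofFn u)) := by
  rw [← (Fin.consEquiv fun _ : Fin (n + 1) => Fin d).sum_comp, Fintype.sum_prod_type]
  refine Finset.sum_congr rfl fun k _ => Finset.sum_congr rfl fun u _ => ?_
  simp only [Fin.consEquiv, Equiv.coe_fn_mk, List.ofFn_cons]
  rfl

lemma adjoint_wordOp_of_mul_apply (T : Fin d → H →L[ℂ] H) (k : Fin d) (w : FreeMonoid (Fin d))
    (x : H) :
    adjoint (wordOp T (FreeMonoid.of k * w)) x = adjoint (wordOp T w) (adjoint (T k) x) := by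
  refine ext_inner_left ℂ fun y => ?_
  rw [adjoint_inner_right, wordOp_of_mul_apply, adjoint_inner_right, adjoint_inner_right]

lemma adjoint_wordOp_one_apply (T : Fin d → H →L[ℂ] H) (x : H) :
    adjoint (wordOp T 1) x = x := by
  refine ext_inner_left ℂ fun y => ?_
  rw [adjoint_inner_right, wordOp_one_apply]

lemma sum_defect_sq {T : Fin d → H →L[ℂ] H} {D : H →L[ℂ] H}
    (hD : ∀ x, ‖D x‖ ^ 2 = ‖x‖ ^ 2 - ∑ k, ‖adjoint (T k) x‖ ^ 2) (n : ℕ) (x : H) :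
    ∑ u : Fin n → Fin d, ‖D (adjoint (wordOp T (FreeMonoid.ofList (List.ofFn u))) x)‖ ^ 2 =
      (∑ u : Fin n → Fin d, ‖adjoint (wordOp T (FreeMonoid.ofList (List.ofFn u))) x‖ ^ 2) -
      ∑ u : Fin (n + 1) → Fin d,
        ‖adjoint (wordOp T (FreeMonoid.ofList (List.ofFn u))) x‖ ^ 2 := by
  induction n generalizing x with
  | zero =>
    rw [sum_ofFn_succ (fun w => ‖adjoint (wordOp T w) x‖ ^ 2)]
    simp only [adjoint_wordOp_of_mul_apply]
    simp [adjoint_wordOp_one_apply, hD]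
  | succ n ih =>
    rw [sum_ofFn_succ (fun w => ‖D (adjoint (wordOp T w) x)‖ ^ 2),
      sum_ofFn_succ (fun w => ‖adjoint (wordOp T w) x‖ ^ 2) n,
      sum_ofFn_succ (fun w => ‖adjoint (wordOp T w) x‖ ^ 2) (n + 1), ← Finset.sum_sub_distrib]
    simp only [adjoint_wordOp_of_mul_apply]
    exact Finset.sum_congr rfl fun k _ => ih _

/-- By purity the sum over all words telescopes to `‖x‖²`. -/
lemma hasSum_defect_sq {T : Fin d → H →L[ℂ] H} (hpure : IsPure T) {D : H →L[ℂ] H}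
    (hD : ∀ x, ‖D x‖ ^ 2 = ‖x‖ ^ 2 - ∑ k, ‖adjoint (T k) x‖ ^ 2) (x : H) :
    HasSum (fun w : FreeMonoid (Fin d) => ‖D (adjoint (wordOp T w) x)‖ ^ 2) (‖x‖ ^ 2) := by
  let e : (Σ n, Fin n → Fin d) ≃ FreeMonoid (Fin d) :=
    List.equivSigmaTuple.symm.trans FreeMonoid.ofList
  rw [← e.hasSum_iff]
  have hlevel (n : ℕ) := hasSum_fintype (fun u : Fin n → Fin d =>
    ‖D (adjoint (wordOp T (FreeMonoid.ofList (List.ofFn u))) x)‖ ^ 2)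
  have htotal : HasSum (fun n : ℕ => ∑ u : Fin n → Fin d,
      ‖D (adjoint (wordOp T (FreeMonoid.ofList (List.ofFn u))) x)‖ ^ 2) (‖x‖ ^ 2) := by
    rw [hasSum_iff_tendsto_nat_of_nonneg (fun n => Finset.sum_nonneg fun u _ => sq_nonneg _)]
    simp only [sum_defect_sq hD, Finset.sum_range_sub']
    simpa [adjoint_wordOp_one_apply] using (hpure x).const_sub (‖x‖ ^ 2)
  refine htotal.sigma_of_hasSum hlevel ?_
  refine (summable_sigma_of_nonneg fun _ => sq_nonneg _).2 ⟨fun n => (hlevel n).summable, ?_⟩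
  convert htotal.summable with n
  exact (hlevel n).tsum_eq

/-- A pure row contraction is the compression of the word shift to a co-invariant subspace: the
isometry is `x ↦ (Δ T_w^* x)_w`. -/
theorem exists_isometry_intertwining {T : Fin d → H →L[ℂ] H} (hT : IsRowContraction T)
    (hpure : IsPure T) :
    ∃ W : H →ₗᵢ[ℂ] WordSpace H d, ∀ k f,
      adjoint W.toContinuousLinearMap (wordShift H k f) =
        T k (adjoint W.toContinuousLinearMap f) := by
  obtain ⟨D, hD⟩ := hT.exists_defect
  have hsum (x : H) : HasSum (fun w : FreeMonoid (Fin d) =>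
      ‖D (adjoint (wordOp T w) x)‖ ^ (2 : ENNReal).toReal) (‖x‖ ^ (2 : ENNReal).toReal) := by
    simpa using hasSum_defect_sq hpure hD x
  let W : H →ₗᵢ[ℂ] WordSpace H d :=
    { toFun := fun x => ⟨fun w => D (adjoint (wordOp T w) x), memℓp_gen (hsum x).summable⟩
      map_add' := fun x y => by ext w; simp; rfl
      map_smul' := fun c x => by ext w; simp
      norm_map' := fun x => by
        have h := lp.hasSum_norm (p := 2) (by norm_num)
          (⟨fun w => D (adjoint (wordOp T w) x), memℓp_gen (hsum x).summable⟩ : WordSpace H d)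
        have := h.unique (hsum x)
        simp only [ENNReal.toReal_ofNat, Real.rpow_ofNat] at this
        exact (sq_eq_sq₀ (norm_nonneg _) (norm_nonneg _)).1 this }
  refine ⟨W, fun k f => ext_inner_left ℂ fun x => ?_⟩
  rw [adjoint_inner_right, ← adjoint_inner_left, ← adjoint_inner_left (T k),
    adjoint_inner_right]
  congr 1
  ext w
  rw [adjoint_wordShift_apply]
  exact congrArg D (adjoint_wordOp_of_mul_apply T k w x)

/-- The contractive image of an orthonormal family satisfies `∑ ξ_i ⊗ ξ_i ≤ I`. -/
lemma exists_sum_rankOne_le {ι K : Type*} [NormedAddCommGroup K] [InnerProductSpace ℂ K]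
    [CompleteSpace K] {v : ι → K} (hv : Orthonormal ℂ v) (W : H →ₗᵢ[ℂ] K) :
    ∃ S : H →L[ℂ] H,
      (∀ h : H, HasSum (fun i => InnerProductSpace.rankOne ℂ
        (adjoint W.toContinuousLinearMap (v i)) (adjoint W.toContinuousLinearMap (v i)) h) (S h)) ∧
      S ≤ ContinuousLinearMap.id ℂ H := by
  classical
  let J : lp (fun _ : ι => ℂ) 2 →ₗᵢ[ℂ] K := hv.orthogonalFamily.linearIsometry
  let R : H →L[ℂ] lp (fun _ : ι => ℂ) 2 :=
    adjoint J.toContinuousLinearMap ∘L W.toContinuousLinearMap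
  have hR : ‖R‖ ≤ 1 := by
    refine (opNorm_comp_le _ _).trans (mul_le_one₀ ?_ (norm_nonneg _) W.norm_toContinuousLinearMap_le)
    rw [LinearIsometryEquiv.norm_map]
    exact J.norm_toContinuousLinearMap_le
  have hcoord (h : H) (i : ι) : R h i = ⟪adjoint W.toContinuousLinearMap (v i), h⟫_ℂ := by
    have h1 : J (lp.single 2 i 1) = v i := by
      exact (hv.orthogonalFamily.linearIsometry_apply_single (i := i) (1 : ℂ)).trans (by simp)
    have h2 := lp.inner_single_left (𝕜 := ℂ) i (1 : ℂ) (R h)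
    rw [adjoint_inner_left, ← h1]
    simpa [R, adjoint_inner_right] using h2.symm
  refine ⟨adjoint R ∘L R, fun h => ?_, ?_⟩
  · have h1 := (hv.orthogonalFamily.hasSum_linearIsometry (R h)).mapL
      (adjoint W.toContinuousLinearMap)
    have h2 : adjoint W.toContinuousLinearMap (J (R h)) = (adjoint R ∘L R) h := by
      simp [R, adjoint_comp]
    rw [← h2]
    convert h1 using 2 with i
    simp [hcoord]
  · rw [ContinuousLinearMap.le_def, isPositive_iff_complex]
    intro x
    have hx : ⟪(ContinuousLinearMap.id ℂ H - adjoint R ∘L R) x, x⟫_ℂ =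
        ((‖x‖ ^ 2 - ‖R x‖ ^ 2 : ℝ) : ℂ) := by
      rw [Complex.ofReal_sub, ← inner_self_eq_ofReal_norm_sq, ← inner_self_eq_ofReal_norm_sq,
        ← adjoint_inner_left, ← inner_sub_left]
      rfl
    rw [hx]
    refine ⟨congrArg _ (Complex.ofReal_re _), ?_⟩
    rw [RCLike.re_to_complex, Complex.ofReal_re, sub_nonneg]
    have : ‖R x‖ ≤ ‖x‖ := by simpa using R.le_of_opNorm_le hR x
    gcongr

/-- The adjoint of the Poisson isometry carries a generator with orthonormal orbit to the
required cyclic vector. -/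
theorem exists_cyclic_weaklyOrthogonal {T : Fin d → H →L[ℂ] H} (hT : IsRowContraction T)
    (hpure : IsPure T) (hcyc : IsCyclic T) :
    ∃ ξ : H, IsCyclicVector T ξ ∧ WeaklyOrthogonal T ξ := by
  obtain ⟨η, hη⟩ := hcyc
  rcases eq_or_ne η 0 with rfl | hη0
  · -- Then `H` is the zero space.
    refine ⟨0, hη, 0, fun h => by simp [hasSum_zero], ?_⟩
    exact (nonneg_iff_isPositive _).2 isPositive_one
  obtain ⟨W, hW⟩ := exists_isometry_intertwining hT hpure
  obtain ⟨ω, hω, hmem⟩ := exists_orthonormal_generator_wordShift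
    (ζ := W η) (fun h => hη0 (W.injective (by rw [h, map_zero])))
  set C := adjoint W.toContinuousLinearMap with hC
  have hword (w : FreeMonoid (Fin d)) : wordOp T w (C ω) = C (wordOp (wordShift H) w ω) := by
    induction w using FreeMonoid.inductionOn' with
    | one => simp
    | of_mul k w ih => rw [wordOp_of_mul_apply, wordOp_of_mul_apply, ih, hW]
  refine ⟨C ω, ?_, ?_⟩
  · have h1 : C (W η) ∈ orbitClosure T (C ω) :=
      map_mem_of_mem_orbitClosure (isClosed_orbitClosure _ _) C
        (fun w => by rw [← hword]; exact wordOp_mem_orbitClosure T _ w) hmem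
    have h2 : C (W η) = η := by
      refine ext_inner_left ℂ fun x => ?_
      rw [adjoint_inner_right]
      exact W.inner_map_map x η
    rw [h2] at h1
    refine top_le_iff.1 (hη.ge.trans ?_)
    exact orbitClosure_le (isClosed_orbitClosure _ _)
      fun w => wordOp_mem_orbitClosure_of_mem w h1
  · simpa only [WeaklyOrthogonal, hword] using exists_sum_rankOne_le hω W

end Poisson

/-! ### The vacuum orbit in the full Fock space -/

section Fock

variable {d : ℕ}

lemma inner_creation (e f : EuclideanSpace ℂ (Fin d)) (v w : FullFock d) :
    ⟪creation e v, creation f w⟫_ℂ = ⟪e, f⟫_ℂ * ⟪v, w⟫_ℂ := by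
  refine (lp.hasSum_inner (creation e v) (creation f w)).unique ?_
  rw [← hasSum_nat_add_iff' 1]
  have h := (lp.hasSum_inner v w).mul_left ⟪e, f⟫_ℂ
  have h0 : ⟪creation e v 0, creation f w 0⟫_ℂ = 0 := inner_zero_left _
  rw [Finset.sum_range_one, h0, sub_zero]
  exact h

lemma isRowIsometry_standardShift : IsRowIsometry (standardShift d) := by
  intro j k v w
  rw [standardShift, standardShift, inner_creation]
  split_ifs with h
  · subst h; simp
  · have h0 : ⟪EuclideanSpace.single j (1 : ℂ), EuclideanSpace.single k (1 : ℂ)⟫_ℂ = 0 := by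
      rw [EuclideanSpace.inner_single_left]
      simp [h]
    rw [h0, zero_mul]

/-- A scalar, regarded as an element of `(ℂ^d)^{⊗ 0} = ℂ`. -/
def scalarLevel (d : ℕ) (c : ℂ) : FockLevel d 0 := c

/-- The vacuum vector `1 ∈ ℂ = (ℂ^d)^{⊗ 0}`. -/
def vacuum (d : ℕ) : FullFock d := lp.single 2 0 (scalarLevel d 1)

/-- The map `e ↦ e ⊗ v` from `ℂ^d` to `(ℂ^d)^{⊗ (n+1)}`. -/
def tensorRight {n : ℕ} (v : FockLevel d n) : EuclideanSpace ℂ (Fin d) →ₗ[ℂ] FockLevel d (n + 1) :=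
  (TensorProduct.mk ℂ (EuclideanSpace ℂ (Fin d)) (FockLevel d n)).flip v

lemma tensorLeft_eq_tensorRight (e : EuclideanSpace ℂ (Fin d)) {n : ℕ} (v : FockLevel d n) :
    tensorLeft e n v = tensorRight v e :=
  rfl

lemma fockLevel_induction {n : ℕ} {motive : FockLevel d (n + 1) → Prop} (zero : motive 0)
    (tmul : ∀ e v, motive (tensorLeft e n v)) (add : ∀ x y, motive x → motive y → motive (x + y))
    (v : FockLevel d (n + 1)) : motive v :=
  TensorProduct.induction_on v zero tmul add

lemma orthonormal_wordOp_vacuum :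
    Orthonormal ℂ (fun w : FreeMonoid (Fin d) => wordOp (standardShift d) w (vacuum d)) := by
  refine isRowIsometry_standardShift.orthonormal_wordOp ?_ fun k w => ?_
  · exact (lp.norm_single (by norm_num) 0 _).trans (norm_one (α := ℂ))
  · rw [vacuum, lp.inner_single_left]
    exact inner_zero_right _

lemma creation_single (e : EuclideanSpace ℂ (Fin d)) (n : ℕ) (v : FockLevel d n) :
    creation e (lp.single 2 n v) = lp.single 2 (n + 1) (tensorLeft e n v) := by
  ext m
  cases m with
  | zero => exact (lp.single_apply_ne 2 (n + 1) _ (Nat.succ_ne_zero n).symm).symm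
  | succ m =>
    change tensorLeft e m (lp.single 2 n v m) = _
    rcases eq_or_ne m n with rfl | h
    · rw [lp.single_apply_self, lp.single_apply_self]
    · rw [lp.single_apply_ne _ _ _ h, lp.single_apply_ne _ _ _ (by simpa using h), map_zero]

lemma single_mem_orbitClosure_vacuum (n : ℕ) (v : FockLevel d n) :
    (lp.single 2 n v : FullFock d) ∈ orbitClosure (standardShift d) (vacuum d) := by
  induction n with
  | zero =>
    obtain ⟨c, rfl⟩ : ∃ c : ℂ, scalarLevel d c = v := ⟨v, rfl⟩
    have hc : scalarLevel d c = c • scalarLevel d 1 := (mul_one c).symm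
    rw [hc, lp.single_smul]
    exact Submodule.smul_mem _ _ (self_mem_orbitClosure _ _)
  | succ n ih =>
    induction v using fockLevel_induction with
    | zero =>
      rw [lp.single_zero]
      exact Submodule.zero_mem _
    | tmul e v =>
      have he : e = ∑ k, e k • EuclideanSpace.single k (1 : ℂ) := by
        ext j
        simp [Pi.single_apply]
      have h : (lp.single 2 (n + 1) (tensorLeft e n v) : FullFock d) =
          ∑ k, e k • standardShift d k (lp.single 2 n v) := by
        simp only [standardShift, creation_single, ← lp.single_smul]
        have hev : tensorLeft e n v =
            ∑ k, e k • tensorLeft (EuclideanSpace.single k (1 : ℂ)) n v := by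
          conv_lhs => rw [he]
          simp only [tensorLeft_eq_tensorRight, map_sum, map_smul]
        rw [hev]
        exact map_sum (lp.singleAddMonoidHom (E := fun n => FockLevel d n) 2 (n + 1)) _ _
      rw [h]
      exact Submodule.sum_mem _ fun k _ =>
        Submodule.smul_mem _ _ (apply_mem_orbitClosure k (ih v))
    | add x y hx hy =>
      rw [lp.single_add]
      exact Submodule.add_mem _ hx hy

lemma isCyclicVector_vacuum : IsCyclicVector (standardShift d) (vacuum d) := by
  refine top_le_iff.1 fun f _ => ?_
  have h := lp.hasSum_single (p := 2) (by norm_num) f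
  exact (isClosed_orbitClosure (standardShift d) (vacuum d)).mem_of_tendsto h
    (Eventually.of_forall fun s => Submodule.sum_mem _ fun n _ =>
      single_mem_orbitClosure_vacuum n (f n))

instance finiteDimensional_fockLevel (n : ℕ) : FiniteDimensional ℂ (FockLevel d n) := by
  induction n with
  | zero => exact inferInstanceAs (FiniteDimensional ℂ ℂ)
  | succ n ih =>
    exact inferInstanceAs
      (FiniteDimensional ℂ (TensorProduct ℂ (EuclideanSpace ℂ (Fin d)) (FockLevel d n)))

instance completeSpace_fockLevel (n : ℕ) : CompleteSpace (FockLevel d n) :=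
  FiniteDimensional.complete ℂ _

end Fock

/-! ### Cyclic vectors with orbit of unit vectors -/

section Rigidity

variable {H : Type*} [NormedAddCommGroup H] [InnerProductSpace ℂ H] {d : ℕ}

/-- Two tuples with cyclic vectors whose orbits are orthonormal are unitarily equivalent. -/
lemma unitarilyEquivalent_of_orthonormal [CompleteSpace H] {K : Type*} [NormedAddCommGroup K]
    [InnerProductSpace ℂ K] [CompleteSpace K] {T : Fin d → H →L[ℂ] H} {V : Fin d → K →L[ℂ] K}
    {ξ : H} {ω : K} (hξ : IsCyclicVector T ξ) (hω : IsCyclicVector V ω)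
    (hTξ : Orthonormal ℂ (fun w => wordOp T w ξ)) (hVω : Orthonormal ℂ (fun w => wordOp V w ω)) :
    UnitarilyEquivalent T V := by
  classical
  let b := HilbertBasis.mk hTξ hξ.ge
  let c := HilbertBasis.mk hVω hω.ge
  let U : H ≃ₗᵢ[ℂ] K := b.repr.trans c.repr.symm
  have hU (w : FreeMonoid (Fin d)) : U (wordOp T w ξ) = wordOp V w ω := by
    have hb : b w = wordOp T w ξ := congrFun (HilbertBasis.coe_mk hTξ hξ.ge) w
    have hc : c w = wordOp V w ω := congrFun (HilbertBasis.coe_mk hVω hω.ge) w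
    rw [← hb, ← hc, LinearIsometryEquiv.trans_apply, b.repr_self, c.repr_symm_single]
  refine ⟨U, fun k x => ?_⟩
  have hx : x ∈ orbitClosure T ξ := hξ.ge trivial
  have := map_mem_of_mem_orbitClosure (P := (⊥ : Submodule ℂ K)) (by simp)
    ((U : H →L[ℂ] K) ∘L T k - V k ∘L (U : H →L[ℂ] K))
    (fun w => by
      have h := hU (FreeMonoid.of k * w)
      rw [wordOp_of_mul_apply, wordOp_of_mul_apply, ← hU w] at h
      simpa [sub_eq_zero] using h) hx
  simpa [sub_eq_zero] using this

lemma WeaklyOrthogonal.hasSum_norm_inner_sq_le {T : Fin d → H →L[ℂ] H} {ξ : H}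
    (h : WeaklyOrthogonal T ξ) (x : H) :
    ∃ s ≤ ‖x‖ ^ 2, HasSum (fun w : FreeMonoid (Fin d) => ‖⟪wordOp T w ξ, x⟫_ℂ‖ ^ 2) s := by
  obtain ⟨S, hS, hle⟩ := h
  refine ⟨RCLike.re ⟪x, S x⟫_ℂ, ?_, ?_⟩
  · have h1 := ((ContinuousLinearMap.le_def _ _).1 hle).re_inner_nonneg_right x
    simp only [sub_apply, id_apply, inner_sub_right, map_sub, sub_nonneg] at h1
    rwa [inner_self_eq_norm_sq] at h1
  · have h1 := ((hS x).mapL (innerSL ℂ x)).mapL Complex.reCLM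
    convert h1 using 1
    funext w
    simp only [InnerProductSpace.rankOne_apply, innerSL_apply_apply, inner_smul_right,
      Complex.reCLM_apply]
    rw [← inner_conj_symm x, Complex.mul_conj, Complex.ofReal_re, Complex.normSq_eq_norm_sq]
    rfl

/-- If every `T_w ξ` has norm at least one, the diagonal term in the sum of squares of inner
products with `T_v ξ` already exhausts the bound `‖T_v ξ‖²`. -/
lemma WeaklyOrthogonal.orthonormal {T : Fin d → H →L[ℂ] H} {ξ : H} (h : WeaklyOrthogonal T ξ)
    (hnorm : ∀ w, 1 ≤ ‖wordOp T w ξ‖) : Orthonormal ℂ (fun w => wordOp T w ξ) := by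
  classical
  have hsum (v : FreeMonoid (Fin d)) (s : Finset (FreeMonoid (Fin d))) :
      ∑ w ∈ s, ‖⟪wordOp T w ξ, wordOp T v ξ⟫_ℂ‖ ^ 2 ≤ ‖wordOp T v ξ‖ ^ 2 := by
    obtain ⟨b, hb, hs⟩ := h.hasSum_norm_inner_sq_le (wordOp T v ξ)
    exact (sum_le_hasSum s (fun _ _ => sq_nonneg _) hs).trans hb
  have hdiag (v : FreeMonoid (Fin d)) : ‖⟪wordOp T v ξ, wordOp T v ξ⟫_ℂ‖ = ‖wordOp T v ξ‖ ^ 2 := by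
    rw [inner_self_eq_norm_sq_to_K]
    simp
  have hone (v : FreeMonoid (Fin d)) : ‖wordOp T v ξ‖ = 1 := by
    have h1 := hsum v {v}
    rw [Finset.sum_singleton, hdiag] at h1
    refine le_antisymm ?_ (hnorm v)
    by_contra! hlt
    have h2 : 1 < ‖wordOp T v ξ‖ ^ 2 := one_lt_pow₀ hlt two_ne_zero
    nlinarith
  refine ⟨hone, fun u v huv => ?_⟩
  have h1 := hsum v {u, v}
  rw [Finset.sum_pair huv, hdiag, hone] at h1
  have h2 : ‖⟪wordOp T u ξ, wordOp T v ξ⟫_ℂ‖ ^ 2 ≤ 0 := by linarith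
  exact norm_eq_zero.1 (pow_eq_zero_iff two_ne_zero |>.1 (le_antisymm h2 (sq_nonneg _)))

/-- Commuting operators give `T_1 T_2 ξ = T_2 T_1 ξ`, which is incompatible with orthonormality
of the orbit. -/
lemma IsCommuting.not_orthonormal {T : Fin d → H →L[ℂ] H} (hT : IsCommuting T) (hd : 1 < d)
    (ξ : H) : ¬ Orthonormal ℂ (fun w => wordOp T w ξ) := by
  intro h
  let i : Fin d := ⟨0, by omega⟩
  let j : Fin d := ⟨1, hd⟩
  have hij : i ≠ j := by simp [i, j]
  have hne : FreeMonoid.of i * (FreeMonoid.of j * 1) ≠ FreeMonoid.of j * (FreeMonoid.of i * 1) :=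
    fun e => hij (List.cons_eq_cons.1 e).1
  refine hne (h.linearIndependent.injective ?_)
  simp only [wordOp_of_mul_apply, wordOp_one_apply]
  exact congrArg (fun S : H →L[ℂ] H => S ξ) (hT i j)

end Rigidity

end CyclicRow

end

theorem corollaryC {H : Type*} [NormedAddCommGroup H] [InnerProductSpace ℂ H] [CompleteSpace H]
    (d : ℕ) (hd : 0 < d) (T : Fin d → H →L[ℂ] H)
    (hrow : CyclicRow.IsRowContraction T) (hpure : CyclicRow.IsPure T)
    (hcyc : CyclicRow.IsCyclic T) :
    (∃ ξ : H, CyclicRow.IsCyclicVector T ξ ∧ CyclicRow.WeaklyOrthogonal T ξ) ∧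
    (∀ ξ : H, CyclicRow.IsCyclicVector T ξ → CyclicRow.WeaklyOrthogonal T ξ →
      ((∀ w : FreeMonoid (Fin d), ‖CyclicRow.wordOp T w ξ‖ = 1) →
        CyclicRow.UnitarilyEquivalent T (CyclicRow.standardShift d)) ∧
      (1 < d → CyclicRow.IsCommuting T →
        ∃ w : FreeMonoid (Fin d), ‖CyclicRow.wordOp T w ξ‖ < 1)) := by
  refine ⟨CyclicRow.exists_cyclic_weaklyOrthogonal hrow hpure hcyc,
    fun ξ hξ hwo => ⟨fun h1 => ?_, fun hd2 hcomm => ?_⟩⟩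
  · exact CyclicRow.unitarilyEquivalent_of_orthonormal hξ CyclicRow.isCyclicVector_vacuum
      (hwo.orthonormal fun w => (h1 w).ge) CyclicRow.orthonormal_wordOp_vacuum
  · by_contra! hge
    exact hcomm.not_orthonormal hd2 ξ (hwo.orthonormal hge)
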